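/- Let $T_\infty=(\mathbb N^*,<,\bot,=)$, where $\mathbb N^*$ is the set of finite words over $\mathbb N$, $<$ is the strict prefix order, $\bot$ is incomparability ($u\bot v$ iff neither word is a prefix of the other), and $=$ is equality. MSO is monadic second-order logic. WMSO+B is weak monadic second-order logic (set variables range over finite subsets of the universe) extended by the bounding quantifier $\mathsf B X\,\varphi(X)$, which says that there is $b\in\mathbb N$ such that $|B|\le b$ for every finite subset $B$ of the universe satisfying $\varphi$. A $\mathsf{Bool}(\mathrm{MSO},\mathrm{WMSO{+}B})$-sentence is a Boolean combination of MSO-sentences and WMSO+B-sentences. Structures are non-empty, and a homomorphism is a map (not necessarily injective) that sends related tuples to related tuples. **Theorem.** There is no $\mathsf{Bool}(\mathrm{MSO},\mathrm{WMSO{+}B})$-sentence $\psi$ such that for every countable $\{<,\bot,=\}$-structure $\mathcal A$, in which $<$ and $\bot$ are arbitrary binary relations and $=$ is equality, we have: $\mathcal A\models\psi$ if and only if there is a homomorphism from $\mathcal A$ to $T_\infty$. In particular, the class consisting of the $\{<,\bot\}$-reduct of $T_\infty$ alone does not have the property EHD. Here a class $\Gamma$ of $\{<,\bot\}$-structures has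 EHD if there is a $\mathsf{Bool}(\mathrm{MSO},\mathrm{WMSO{+}B})$-sentence $\varphi$ such that for every countable $\{<,\bot\}$-structure $\mathcal B$: $\mathcal B\models\varphi$ if and only if there is a homomorphism from $\mathcal B$ to some structure in $\Gamma$. -/

import Mathlib

open FirstOrder FirstOrder.Language

/-! Words over `ℕ`, signatures and structures.

A relational signature is a `FirstOrder.Language` without function symbols, a structure over it is
a `FirstOrder.Language.Structure`, and homomorphisms `A →[L] B` are Mathlib's: maps that send
related tuples to related tuples (they need be neither injective nor strong). -/

/-- The relation symbols of `{<, ⊥}`, both binary. -/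
inductive OrderRel : ℕ → Type
  | lt : OrderRel 2
  | bot : OrderRel 2

/-- The relation symbols of `{<, ⊥, =}`, all binary. -/
inductive OrderEqRel : ℕ → Type
  | lt : OrderEqRel 2
  | bot : OrderEqRel 2
  | eq : OrderEqRel 2

/-- The signature `{<, ⊥}`. -/
abbrev orderSig : FirstOrder.Language.{0, 0} := ⟨fun _ => Empty, OrderRel⟩

/-- The signature `{<, ⊥, =}`. -/
abbrev orderEqSig : FirstOrder.Language.{0, 0} := ⟨fun _ => Empty, OrderEqRel⟩

/-- The universe of the infinitely branching infinite order tree: all finite words over `ℕ`. -/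
def TInf : Type := List ℕ

namespace TInf

/-- The strict prefix order on words. -/
def lt (u v : TInf) : Prop := List.IsPrefix u v ∧ u ≠ v

/-- Incomparability with respect to the prefix order. -/
def bot (u v : TInf) : Prop := ¬ List.IsPrefix u v ∧ ¬ List.IsPrefix v u

/-- The tree as a `{<, ⊥}`-structure. -/
instance instOrder : orderSig.Structure TInf where
  funMap := fun f _ => nomatch f
  RelMap := fun R v =>
    match R, v with
    | OrderRel.lt, v => lt (v 0) (v 1)
    | OrderRel.bot, v => bot (v 0) (v 1)

/-- The tree as a `{<, ⊥, =}`-structure. -/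
instance instOrderEq : orderEqSig.Structure TInf where
  funMap := fun f _ => nomatch f
  RelMap := fun R v =>
    match R, v with
    | OrderEqRel.lt, v => lt (v 0) (v 1)
    | OrderEqRel.bot, v => bot (v 0) (v 1)
    | OrderEqRel.eq, v => v 0 = v 1

end TInf

/-- A `{<, ⊥, =}`-structure in which the symbol `=` is interpreted as equality. -/
def InterpretsEq (A : Type) [orderEqSig.Structure A] : Prop :=
  ∀ a b : A, Structure.RelMap (L := orderEqSig) OrderEqRel.eq ![a, b] ↔ a = b

/-! The logics. Variables are numbered by the quantifiers that bind them: a formula in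
`MSO L n m` or `WMSOB L n m` has its free first-order variables among `x₀, …, xₙ₋₁` and its free
second-order variables among `X₀, …, Xₘ₋₁`; a quantifier over a formula with `n + 1` (or `m + 1`)
variables of its sort binds the last one. The sentences are the formulas with `n = m = 0`. -/

/-- Monadic second-order formulas over the relational signature `L`. -/
inductive MSO (L : FirstOrder.Language.{0, 0}) : ℕ → ℕ → Type
  | rel {n m r : ℕ} (R : L.Relations r) (x : Fin r → Fin n) : MSO L n m
  | equal {n m : ℕ} (x y : Fin n) : MSO L n m
  | mem {n m : ℕ} (x : Fin n) (X : Fin m) : MSO L n m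
  | not {n m : ℕ} (φ : MSO L n m) : MSO L n m
  | and {n m : ℕ} (φ ψ : MSO L n m) : MSO L n m
  | existsElem {n m : ℕ} (φ : MSO L (n + 1) m) : MSO L n m
  | existsSet {n m : ℕ} (φ : MSO L n (m + 1)) : MSO L n m

/-- Formulas of weak monadic second-order logic with the bounding quantifier. -/
inductive WMSOB (L : FirstOrder.Language.{0, 0}) : ℕ → ℕ → Type
  | rel {n m r : ℕ} (R : L.Relations r) (x : Fin r → Fin n) : WMSOB L n m
  | equal {n m : ℕ} (x y : Fin n) : WMSOB L n m
  | mem {n m : ℕ} (x : Fin n) (X : Fin m) : WMSOB L n m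
  | not {n m : ℕ} (φ : WMSOB L n m) : WMSOB L n m
  | and {n m : ℕ} (φ ψ : WMSOB L n m) : WMSOB L n m
  | existsElem {n m : ℕ} (φ : WMSOB L (n + 1) m) : WMSOB L n m
  | existsSet {n m : ℕ} (φ : WMSOB L n (m + 1)) : WMSOB L n m
  | bound {n m : ℕ} (φ : WMSOB L n (m + 1)) : WMSOB L n m

/-- Satisfaction for `MSO`: set variables range over all subsets of the universe. -/
def MSO.Sat {L : FirstOrder.Language.{0, 0}} (A : Type) [L.Structure A] :
    {n m : ℕ} → MSO L n m → (Fin n → A) → (Fin m → Set A) → Prop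
  | _, _, .rel R x, a, _ => Structure.RelMap R (fun i => a (x i))
  | _, _, .equal x y, a, _ => a x = a y
  | _, _, .mem x X, a, S => a x ∈ S X
  | _, _, .not φ, a, S => ¬ φ.Sat A a S
  | _, _, .and φ ψ, a, S => φ.Sat A a S ∧ ψ.Sat A a S
  | n, _, .existsElem φ, a, S => ∃ b : A, φ.Sat A (Fin.snoc (n := n) (α := fun _ => A) a b) S
  | _, m, .existsSet φ, a, S =>
      ∃ B : Set A, φ.Sat A a (Fin.snoc (n := m) (α := fun _ => Set A) S B)

/-- Satisfaction for `WMSO+B`: set variables range over the finite subsets of the universe, and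
the bounding quantifier says that the finite sets with the given property have bounded size. -/
def WMSOB.Sat {L : FirstOrder.Language.{0, 0}} (A : Type) [L.Structure A] :
    {n m : ℕ} → WMSOB L n m → (Fin n → A) → (Fin m → Finset A) → Prop
  | _, _, .rel R x, a, _ => Structure.RelMap R (fun i => a (x i))
  | _, _, .equal x y, a, _ => a x = a y
  | _, _, .mem x X, a, S => a x ∈ S X
  | _, _, .not φ, a, S => ¬ φ.Sat A a S
  | _, _, .and φ ψ, a, S => φ.Sat A a S ∧ ψ.Sat A a S
  | n, _, .existsElem φ, a, S => ∃ b : A, φ.Sat A (Fin.snoc (n := n) (α := fun _ => A) a b) S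
  | _, m, .existsSet φ, a, S =>
      ∃ B : Finset A, φ.Sat A a (Fin.snoc (n := m) (α := fun _ => Finset A) S B)
  | _, m, .bound φ, a, S =>
      ∃ b : ℕ, ∀ B : Finset A,
        φ.Sat A a (Fin.snoc (n := m) (α := fun _ => Finset A) S B) → B.card ≤ b

/-- Sentences of `Bool(MSO, WMSO+B)`: Boolean combinations of `MSO`-sentences and
`WMSO+B`-sentences. -/
inductive BoolSentence (L : FirstOrder.Language.{0, 0}) : Type
  | mso (φ : MSO L 0 0) : BoolSentence L
  | wmsob (φ : WMSOB L 0 0) : BoolSentence L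
  | not (ψ : BoolSentence L) : BoolSentence L
  | and (ψ χ : BoolSentence L) : BoolSentence L

/-- `ψ.Holds A` says that the structure `A` is a model of `ψ`. -/
def BoolSentence.Holds {L : FirstOrder.Language.{0, 0}} (A : Type) [L.Structure A] :
    BoolSentence L → Prop
  | .mso φ => φ.Sat A Fin.elim0 Fin.elim0
  | .wmsob φ => φ.Sat A Fin.elim0 Fin.elim0
  | .not ψ => ¬ ψ.Holds A
  | .and ψ χ => ψ.Holds A ∧ χ.Holds A

/-- A class `Γ` of `{<, ⊥}`-structures has the property EHD: the existence of a homomorphism to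
a structure from `Γ` is definable by a `Bool(MSO, WMSO+B)`-sentence on the countable
`{<, ⊥}`-structures. -/
def HasEHD (Γ : Set (CategoryTheory.Bundled.{0, 0} orderSig.Structure)) : Prop :=
  ∃ ψ : BoolSentence orderSig, ∀ (B : Type) [Nonempty B] [Countable B] [orderSig.Structure B],
    (∃ A ∈ Γ, letI := A.str; Nonempty (B →[orderSig] A.α)) ↔ ψ.Holds B

/-! The counterexamples consist of a point `u` and, for each `i`, two finite chains with a common
upper bound (`join`); the left chain also lies below a point above `u`, the right one below a point
incomparable to `u`. In a tree, upper bounds force the tops of the two chains to be comparable. If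
both chains are longer than the word assigned to `u`, then `u` becomes a prefix of the point it
should be incomparable to (`not_exists_isTreeMap`). If in every component one of the chains has
length at most a fixed `K`, the structure maps to the tree (`exists_isTreeMap`). So the question is
whether pairs of chains are simultaneously unbounded.

Sentences of rank `k` cannot see this. There are finitely many rank `k` types of chains, so
infinitely many lengths share one type. With these lengths only, one structure pairs every length
with the shortest one, on either side, and the other pairs all lengths with each other
(`exists_indistinguishable`). For MSO, an Ehrenfeucht–Fraïssé argument played separately on each
piece suffices (`mso_sat`).

For the bounding quantifier, large sets must be answered by large sets (`Matches.exists_large`). A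
large finite set meets many pieces, and then so does any piecewise answer; or it is large on one
long chain. If that chain is longer than all those in components touched by the finite parameters,
its component is untouched. It can then be rematched with an untouched component whose corresponding
chain has exactly the same length, and the trace is copied. This needs only one chain of the
component to have the right length, so it never reveals how lengths are paired. -/

/-! Types of finite chains with set parameters. -/

/-- The family `U` of sets, extended by one more set `B`. -/
def extendSets {V α : Type} (U : V → Set α) (B : Set α) : Option V → Set α :=
  fun o => o.elim B U

/-- The rank `k` types of a chain with set parameters indexed by `V`. -/
def ChainType : ℕ → Type → Type
  | 0, V => (V → V → Prop) × (V → V → Prop)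
  | k + 1, V => ((V → V → Prop) × (V → V → Prop)) × Set (ChainType k (Option V))

instance ChainType.finite : ∀ (k : ℕ) (V : Type) [Finite V], Finite (ChainType k V)
  | 0, V, _ => inferInstanceAs (Finite ((V → V → Prop) × (V → V → Prop)))
  | k + 1, V, _ =>
    haveI := ChainType.finite k (Option V)
    inferInstanceAs (Finite (((V → V → Prop) × (V → V → Prop)) × Set (ChainType k (Option V))))

/-- The atomic type of a chain with set parameters. -/
def atomicType {V : Type} {n : ℕ} (U : V → Set (Fin n)) : (V → V → Prop) × (V → V → Prop) :=
  (fun p q => ∃ x ∈ U p, ∃ y ∈ U q, x < y, fun p q => (U p ∩ U q).Nonempty)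

/-- The rank `k` type of the chain `Fin n` with set parameters. -/
def chainType : (k : ℕ) → {V : Type} → {n : ℕ} → (V → Set (Fin n)) → ChainType k V
  | 0, _, _, U => atomicType U
  | k + 1, _, _, U => (atomicType U, Set.range fun B => chainType k (extendSets U B))

theorem atomicType_eq_of_chainType_eq {V : Type} {k n n' : ℕ} {U : V → Set (Fin n)}
    {U' : V → Set (Fin n')} (h : chainType k U = chainType k U') :
    atomicType U = atomicType U' := by
  cases k with
  | zero => exact h
  | succ k => exact congrArg Prod.fst h

theorem exists_lt_iff_of_chainType_eq {V : Type} {k n n' : ℕ} {U : V → Set (Fin n)}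
    {U' : V → Set (Fin n')} (h : chainType k U = chainType k U') (p q : V) :
    (∃ x ∈ U p, ∃ y ∈ U q, x < y) ↔ ∃ x ∈ U' p, ∃ y ∈ U' q, x < y :=
  iff_of_eq (congrFun (congrFun (congrArg Prod.fst (atomicType_eq_of_chainType_eq h)) p) q)

theorem inter_nonempty_iff_of_chainType_eq {V : Type} {k n n' : ℕ} {U : V → Set (Fin n)}
    {U' : V → Set (Fin n')} (h : chainType k U = chainType k U') (p q : V) :
    (U p ∩ U q).Nonempty ↔ (U' p ∩ U' q).Nonempty :=
  iff_of_eq (congrFun (congrFun (congrArg Prod.snd (atomicType_eq_of_chainType_eq h)) p) q)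

theorem nonempty_iff_of_chainType_eq {V : Type} {k n n' : ℕ} {U : V → Set (Fin n)}
    {U' : V → Set (Fin n')} (h : chainType k U = chainType k U') (p : V) :
    (U p).Nonempty ↔ (U' p).Nonempty := by
  simpa using inter_nonempty_iff_of_chainType_eq h p p

theorem exists_chainType_extendSets_eq {V : Type} {k n n' : ℕ} {U : V → Set (Fin n)}
    {U' : V → Set (Fin n')} (h : chainType (k + 1) U = chainType (k + 1) U') (B : Set (Fin n)) :
    ∃ B', chainType k (extendSets U B) = chainType k (extendSets U' B') := by
  have h2 : (Set.range fun B => chainType k (extendSets U B)) =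
      Set.range fun B => chainType k (extendSets U' B) := congrArg Prod.snd h
  have h3 : chainType k (extendSets U B) ∈ Set.range fun B => chainType k (extendSets U' B) :=
    h2 ▸ Set.mem_range_self B
  obtain ⟨B', hB'⟩ := h3
  exact ⟨B', hB'.symm⟩

theorem extendSets_empty {V α : Type} :
    extendSets (fun _ : V => (∅ : Set α)) ∅ = fun _ => ∅ := by
  funext o; cases o <;> rfl

/-- The empty set can only be answered by the empty set, since atomic types detect emptiness. This
keeps parameter-free chains equivalent when a new set parameter avoids them. -/
theorem chainType_empty_succ {V : Type} {k n n' : ℕ}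
    (h : chainType (k + 1) (fun _ : V => (∅ : Set (Fin n))) =
      chainType (k + 1) (fun _ : V => (∅ : Set (Fin n')))) :
    chainType k (fun _ : Option V => (∅ : Set (Fin n))) =
      chainType k (fun _ : Option V => (∅ : Set (Fin n'))) := by
  obtain ⟨B', hB'⟩ := exists_chainType_extendSets_eq h ∅
  have h1 := nonempty_iff_of_chainType_eq hB' none
  have h2 : B' = ∅ := by
    by_contra hne
    exact Set.not_nonempty_empty (h1.2 (Set.nonempty_iff_ne_empty.2 hne))
  rwa [h2, extendSets_empty, extendSets_empty] at hB'

/-- There are infinitely many lengths of chains with the same rank `k` type. -/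
theorem exists_strictMono_chainType_eq (k : ℕ) :
    ∃ f : ℕ → ℕ, StrictMono f ∧ ∀ s t,
      chainType k (fun _ : Empty => (∅ : Set (Fin (f s)))) =
        chainType k (fun _ : Empty => (∅ : Set (Fin (f t)))) := by
  obtain ⟨y, hy⟩ := Finite.exists_infinite_fiber
    (fun n : ℕ => chainType k (fun _ : Empty => (∅ : Set (Fin n))))
  have hinf := Set.infinite_coe_iff.1 hy
  exact ⟨Nat.nth (fun n => chainType k (fun _ : Empty => (∅ : Set (Fin n))) = y),
    Nat.nth_strictMono hinf,
    fun s t => (Nat.nth_mem_of_infinite hinf s).trans (Nat.nth_mem_of_infinite hinf t).symm⟩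

/-! Sums of chains. -/

/-- The parts of a component. -/
inductive Role
  | left | right | join | leftEnd | rightEnd

instance : Finite Role :=
  Finite.of_injective (fun r : Role => match r with
    | .left => (0 : Fin 5) | .right => 1 | .join => 2 | .leftEnd => 3 | .rightEnd => 4)
    (by rintro (_ | _) (_ | _) h <;> simp_all)

/-- The order between the parts of a component. -/
def Role.Lt : Role → Role → Prop
  | .left, .leftEnd => True
  | .left, .join => True
  | .right, .rightEnd => True
  | .right, .join => True
  | _, _ => False

/-- The pieces: a common point, and the parts of the components from `I`. -/
abbrev Piece (I : Type) := Option (I × Role)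

/-- The order between different pieces. -/
def Piece.Lt {I : Type} : Piece I → Piece I → Prop
  | none, some (_, p) => p = .leftEnd
  | some (i, r), some (i', r') => i = i' ∧ r.Lt r'
  | _, _ => False

/-- The incomparability relation between pieces. -/
def Piece.Bot {I : Type} : Piece I → Piece I → Prop
  | none, some (_, p) => p = .rightEnd
  | _, _ => False

/-- Permuting the components permutes the pieces. -/
def Piece.perm {I : Type} (τ : I ≃ I) : Piece I ≃ Piece I :=
  Equiv.optionCongr (τ.prodCongr (Equiv.refl _))

theorem Piece.perm_symm {I : Type} (τ : I ≃ I) : (Piece.perm τ).symm = Piece.perm τ.symm := by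
  ext (_ | ⟨i, p⟩) <;> rfl

theorem Piece.lt_perm {I : Type} (τ : I ≃ I) (j j' : Piece I) :
    (Piece.perm τ j).Lt (Piece.perm τ j') ↔ j.Lt j' := by
  rcases j with _ | ⟨i, p⟩ <;> rcases j' with _ | ⟨i', p'⟩ <;> simp [Piece.perm, Piece.Lt]

theorem Piece.bot_perm {I : Type} (τ : I ≃ I) (j j' : Piece I) :
    (Piece.perm τ j).Bot (Piece.perm τ j') ↔ j.Bot j' := by
  rcases j with _ | ⟨i, p⟩ <;> rcases j' with _ | ⟨i', p'⟩ <;> simp [Piece.perm, Piece.Bot]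

/-- The sum of the chains `Fin (c j)`. -/
structure ChainSum {I : Type} (c : Piece I → ℕ) : Type where
  /-- The piece of the element. -/
  piece : Piece I
  /-- The position of the element in its piece. -/
  pos : Fin (c piece)

/-! ### Piecewise equivalence of sums of chains, up to permuting components. -/

namespace ChainSum

variable {I V : Type} {c c' : Piece I → ℕ} {k : ℕ} {τ : I ≃ I}

/-- The order relation of a sum of chains. -/
def Lt (a b : ChainSum c) : Prop := (a.piece = b.piece ∧ a.pos.val < b.pos.val) ∨ a.piece.Lt b.piece

/-- The incomparability relation of a sum of chains. -/
def Bot (a b : ChainSum c) : Prop := a.piece.Bot b.piece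

/-- The trace of a set on a piece. -/
def trace (B : Set (ChainSum c)) (j : Piece I) : Set (Fin (c j)) := {x | ⟨j, x⟩ ∈ B}

/-- Two families of sets in sums of chains have pieces of the same types, up to a permutation of
the components. -/
def Matches (k : ℕ) (τ : I ≃ I) (U : V → Set (ChainSum c)) (U' : V → Set (ChainSum c')) : Prop :=
  ∀ j, chainType k (fun v => trace (U v) j) =
    chainType k (fun v => trace (U' v) (Piece.perm τ j))

variable {U : V → Set (ChainSum c)} {U' : V → Set (ChainSum c')}

theorem Matches.symm (h : Matches k τ U U') : Matches k τ.symm U' U := by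
  intro j
  have := h ((Piece.perm τ).symm j)
  rw [Equiv.apply_symm_apply, Piece.perm_symm] at this
  exact this.symm

theorem trace_nonempty_iff (h : Matches k τ U U') (j : Piece I) (p : V) :
    (trace (U p) j).Nonempty ↔ (trace (U' p) (Piece.perm τ j)).Nonempty :=
  nonempty_iff_of_chainType_eq (h j) p

theorem Matches.inter_nonempty (h : Matches k τ U U') {p q : V} (hpq : (U p ∩ U q).Nonempty) :
    (U' p ∩ U' q).Nonempty := by
  obtain ⟨⟨j, x⟩, hp, hq⟩ := hpq
  obtain ⟨y, hy, hy'⟩ := (inter_nonempty_iff_of_chainType_eq (h j) p q).1 ⟨x, hp, hq⟩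
  exact ⟨⟨_, y⟩, hy, hy'⟩

theorem Matches.exists_lt (h : Matches k τ U U') {p q : V}
    (hpq : ∃ a ∈ U p, ∃ b ∈ U q, a.Lt b) : ∃ a ∈ U' p, ∃ b ∈ U' q, a.Lt b := by
  obtain ⟨⟨j, x⟩, hp, ⟨j', y⟩, hq, ⟨hj, hxy⟩ | hlt⟩ := hpq
  · obtain rfl : j = j' := hj
    obtain ⟨x', hx', y', hy', hlt⟩ :=
      (exists_lt_iff_of_chainType_eq (h j) p q).1 ⟨x, hp, y, hq, hxy⟩
    exact ⟨⟨_, x'⟩, hx', ⟨_, y'⟩, hy', Or.inl ⟨rfl, hlt⟩⟩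
  · obtain ⟨x', hx'⟩ := (trace_nonempty_iff h j p).1 ⟨x, hp⟩
    obtain ⟨y', hy'⟩ := (trace_nonempty_iff h j' q).1 ⟨y, hq⟩
    exact ⟨⟨_, x'⟩, hx', ⟨_, y'⟩, hy', Or.inr ((Piece.lt_perm τ j j').2 hlt)⟩

theorem Matches.exists_bot (h : Matches k τ U U') {p q : V}
    (hpq : ∃ a ∈ U p, ∃ b ∈ U q, a.Bot b) : ∃ a ∈ U' p, ∃ b ∈ U' q, a.Bot b := by
  obtain ⟨⟨j, x⟩, hp, ⟨j', y⟩, hq, hbot⟩ := hpq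
  obtain ⟨x', hx'⟩ := (trace_nonempty_iff h j p).1 ⟨x, hp⟩
  obtain ⟨y', hy'⟩ := (trace_nonempty_iff h j' q).1 ⟨y, hq⟩
  exact ⟨⟨_, x'⟩, hx', ⟨_, y'⟩, hy', (Piece.bot_perm τ j j').2 hbot⟩

/-- Two distinct elements lie in different pieces or are strictly ordered within one piece, and both
situations transfer back. Hence elements can be coded as singletons, and element moves as set moves.
-/
theorem Matches.subsingleton (h : Matches k τ U U') {p : V} (hp : (U p).Subsingleton) :
    (U' p).Subsingleton := by
  rintro ⟨j, x⟩ hx ⟨j', y⟩ hy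
  obtain ⟨x', hx'⟩ := (trace_nonempty_iff h.symm j p).1 ⟨x, hx⟩
  obtain ⟨y', hy'⟩ := (trace_nonempty_iff h.symm j' p).1 ⟨y, hy⟩
  obtain rfl : j = j' := (Piece.perm τ.symm).injective (congrArg ChainSum.piece (hp hx' hy'))
  have key : ∀ x y : Fin (c' j), (⟨j, x⟩ : ChainSum c') ∈ U' p → (⟨j, y⟩ : ChainSum c') ∈ U' p →
      ¬ x < y := by
    intro x y hx hy hxy
    obtain ⟨x', hx', y', hy', hlt⟩ :=
      (exists_lt_iff_of_chainType_eq (h.symm j) p p).1 ⟨x, hx, y, hy, hxy⟩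
    have := hp hx' hy'
    rw [ChainSum.mk.injEq] at this
    exact hlt.ne (eq_of_heq this.2)
  rw [le_antisymm (not_lt.1 (key y x hy hx)) (not_lt.1 (key x y hx hy))]

theorem Matches.exists_singleton (h : Matches k τ U U') {p : V} {a : ChainSum c}
    (hp : U p = {a}) : ∃ a', U' p = {a'} := by
  have h1 : (U' p ∩ U' p).Nonempty := h.inter_nonempty (by rw [hp]; simp)
  obtain ⟨a', ha', -⟩ := h1
  exact ⟨a', (h.subsingleton (by rw [hp]; simp)).eq_singleton_of_mem ha'⟩

theorem finite_of_trace {B : Set (ChainSum c)} {F : Set (Piece I)} (hF : F.Finite)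
    (h : ∀ j, (trace B j).Nonempty → j ∈ F) : B.Finite := by
  have : B ⊆ ⋃ j ∈ F, Set.range (fun x => (⟨j, x⟩ : ChainSum c)) := by
    rintro ⟨j, x⟩ hx
    simp only [Set.mem_iUnion]
    exact ⟨j, h j ⟨x, hx⟩, x, rfl⟩
  exact (hF.biUnion fun j _ => Set.finite_range _).subset this

/-- Pieces are finite, so a set is finite as soon as it meets finitely many of them, and matching
preserves which pieces are met. Answers to weak set moves are therefore legal. -/
theorem Matches.finite (h : Matches k τ U U') {p : V} (hp : (U p).Finite) : (U' p).Finite := by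
  refine finite_of_trace (F := Piece.perm τ '' (ChainSum.piece '' U p)) ((hp.image _).image _) ?_
  intro j hj
  obtain ⟨x, hx⟩ := (trace_nonempty_iff h.symm j p).1 hj
  refine ⟨Piece.perm τ.symm j, ⟨_, hx, rfl⟩, ?_⟩
  rw [← Piece.perm_symm, Equiv.apply_symm_apply]

theorem trace_extendSets (B : Set (ChainSum c)) (j : Piece I) :
    (fun v => trace (extendSets U B v) j) = extendSets (fun v => trace (U v) j) (trace B j) := by
  funext o; cases o <;> rfl

/-- Responses on the pieces combine to a response. -/
theorem exists_matches_extendSets (B : Set (ChainSum c))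
    (Q : ∀ j : Piece I, Set (Fin (c' (Piece.perm τ j))) → Prop)
    (h : ∀ j, ∃ Y, chainType k (extendSets (fun v => trace (U v) j) (trace B j)) =
      chainType k (extendSets (fun v => trace (U' v) (Piece.perm τ j)) Y) ∧ Q j Y) :
    ∃ B', Matches k τ (extendSets U B) (extendSets U' B') ∧
      ∀ j, Q j (trace B' (Piece.perm τ j)) := by
  choose Y hY hQ using h
  -- The answer is the union of the piecewise answers; they do not interfere because `Piece.perm τ`
  -- is injective.
  have key : ∀ j, trace {p : ChainSum c' | ∃ j, ∃ x ∈ Y j, p = ⟨Piece.perm τ j, x⟩}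
      (Piece.perm τ j) = Y j := by
    intro j
    ext x
    constructor
    · rintro ⟨j', x', hx', he⟩
      obtain rfl : j = j' := (Piece.perm τ).injective (congrArg ChainSum.piece he)
      rw [ChainSum.mk.injEq] at he
      rwa [eq_of_heq he.2]
    · exact fun hx => ⟨j, x, hx, rfl⟩
  refine ⟨_, fun j => ?_, fun j => by rw [key]; exact hQ j⟩
  rw [trace_extendSets, trace_extendSets, key]
  exact hY j

theorem Matches.exists_extendSets (h : Matches (k + 1) τ U U') (B : Set (ChainSum c)) :
    ∃ B', Matches k τ (extendSets U B) (extendSets U' B') := by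
  obtain ⟨B', hB', -⟩ := exists_matches_extendSets (k := k) (τ := τ) (U := U) (U' := U') B
    (fun _ _ => True)
    (fun j => (exists_chainType_extendSets_eq (h j) (trace B j)).imp fun _ hY => ⟨hY, trivial⟩)
  exact ⟨B', hB'⟩

/-- The relations of the structures on sums of chains are determined by `Lt`, `Bot`, equality. -/
def Determined (L : FirstOrder.Language.{0, 0}) (I : Type)
    [∀ c : Piece I → ℕ, L.Structure (ChainSum c)] : Prop :=
  ∀ (c c' : Piece I → ℕ) (r : ℕ) (R : L.Relations r) (a : Fin r → ChainSum c)
    (a' : Fin r → ChainSum c'), (∀ p q, (a p).Lt (a q) ↔ (a' p).Lt (a' q)) →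
    (∀ p q, (a p).Bot (a q) ↔ (a' p).Bot (a' q)) → (∀ p q, a p = a q ↔ a' p = a' q) →
    Structure.RelMap R a → Structure.RelMap R a'

theorem Matches.lt_of_lt (h : Matches k τ U U') {p q : V} {a b : ChainSum c} {a' b' : ChainSum c'}
    (hp : U p = {a}) (hp' : U' p = {a'}) (hq : U q = {b}) (hq' : U' q = {b'}) (hab : a.Lt b) :
    a'.Lt b' := by
  have := h.exists_lt (p := p) (q := q) ⟨a, by rw [hp]; rfl, b, by rw [hq]; rfl, hab⟩
  rw [hp', hq'] at this
  obtain ⟨_, rfl, _, rfl, h⟩ := this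
  exact h

theorem Matches.bot_of_bot (h : Matches k τ U U') {p q : V} {a b : ChainSum c}
    {a' b' : ChainSum c'} (hp : U p = {a}) (hp' : U' p = {a'}) (hq : U q = {b}) (hq' : U' q = {b'})
    (hab : a.Bot b) : a'.Bot b' := by
  have := h.exists_bot (p := p) (q := q) ⟨a, by rw [hp]; rfl, b, by rw [hq]; rfl, hab⟩
  rw [hp', hq'] at this
  obtain ⟨_, rfl, _, rfl, h⟩ := this
  exact h

theorem Matches.mem_of_mem (h : Matches k τ U U') {p q : V} {a : ChainSum c} {a' : ChainSum c'}
    (hp : U p = {a}) (hp' : U' p = {a'}) (hq : a ∈ U q) : a' ∈ U' q := by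
  have := h.inter_nonempty (p := p) (q := q) ⟨a, by rw [hp]; rfl, hq⟩
  rw [hp'] at this
  obtain ⟨_, rfl, h⟩ := this
  exact h

theorem Matches.eq_of_eq (h : Matches k τ U U') {p q : V} {a b : ChainSum c}
    {a' b' : ChainSum c'} (hp : U p = {a}) (hp' : U' p = {a'}) (hq : U q = {b}) (hq' : U' q = {b'})
    (hab : a = b) : a' = b' := by
  have := h.mem_of_mem (q := q) hp hp' (by rw [hq, hab]; rfl)
  rw [hq'] at this
  exact this

theorem Matches.relMap {L : FirstOrder.Language.{0, 0}}
    [∀ c : Piece I → ℕ, L.Structure (ChainSum c)] (hL : Determined L I) (h : Matches k τ U U')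
    {r : ℕ} (R : L.Relations r) (e : Fin r → V) {a : Fin r → ChainSum c}
    {a' : Fin r → ChainSum c'} (ha : ∀ x, U (e x) = {a x}) (ha' : ∀ x, U' (e x) = {a' x})
    (hR : Structure.RelMap R a) : Structure.RelMap R a' :=
  hL c c' r R a a'
    (fun p q => ⟨h.lt_of_lt (ha p) (ha' p) (ha q) (ha' q),
      h.symm.lt_of_lt (ha' p) (ha p) (ha' q) (ha q)⟩)
    (fun p q => ⟨h.bot_of_bot (ha p) (ha' p) (ha q) (ha' q),
      h.symm.bot_of_bot (ha' p) (ha p) (ha' q) (ha q)⟩)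
    (fun p q => ⟨h.eq_of_eq (ha p) (ha' p) (ha q) (ha' q),
      h.symm.eq_of_eq (ha' p) (ha p) (ha' q) (ha q)⟩) hR

end ChainSum

/-! ### Quantifier rank and preservation of MSO. -/

/-- The quantifier rank. -/
def MSO.rank {L : FirstOrder.Language.{0, 0}} : {n m : ℕ} → MSO L n m → ℕ
  | _, _, .rel _ _ => 0
  | _, _, .equal _ _ => 0
  | _, _, .mem _ _ => 0
  | _, _, .not φ => φ.rank
  | _, _, .and φ ψ => max φ.rank ψ.rank
  | _, _, .existsElem φ => φ.rank + 1
  | _, _, .existsSet φ => φ.rank + 1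

/-- The quantifier rank. -/
def WMSOB.rank {L : FirstOrder.Language.{0, 0}} : {n m : ℕ} → WMSOB L n m → ℕ
  | _, _, .rel _ _ => 0
  | _, _, .equal _ _ => 0
  | _, _, .mem _ _ => 0
  | _, _, .not φ => φ.rank
  | _, _, .and φ ψ => max φ.rank ψ.rank
  | _, _, .existsElem φ => φ.rank + 1
  | _, _, .existsSet φ => φ.rank + 1
  | _, _, .bound φ => φ.rank + 1

namespace ChainSum

/-- If the old variables denote the old sets, and the last one the new set, then `snoc` of the
variables denotes `snoc` of the values. -/
theorem extendSets_snoc {V α β : Type} {n : ℕ} {U : V → Set α} {e : Fin n → V} {a : Fin n → β}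
    {g : β → Set α} (ha : ∀ x, U (e x) = g (a x)) (b : β) (x : Fin (n + 1)) :
    extendSets U (g b) (Fin.snoc (n := n) (α := fun _ => Option V) (fun x => some (e x)) none x) =
      g (Fin.snoc (n := n) (α := fun _ => β) a b x) := by
  refine Fin.lastCases ?_ (fun x => ?_) x
  · simp [extendSets]
  · simpa [extendSets] using ha x

/-- One implication is enough because both structures and the permutation are universally
quantified: negation exchanges the two sides. The maps `e` and `s` locate the variables among the
sets played so far. -/
theorem mso_sat {L : FirstOrder.Language.{0, 0}} {I : Type}
    [∀ c : Piece I → ℕ, L.Structure (ChainSum c)] (hL : Determined L I) {n m : ℕ}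
    (φ : MSO L n m) : ∀ (c c' : Piece I → ℕ) (τ : I ≃ I) (V : Type) (k : ℕ), φ.rank ≤ k →
    ∀ (U : V → Set (ChainSum c)) (U' : V → Set (ChainSum c')), Matches k τ U U' →
    ∀ (e : Fin n → V) (s : Fin m → V) (a : Fin n → ChainSum c) (a' : Fin n → ChainSum c')
      (S : Fin m → Set (ChainSum c)) (S' : Fin m → Set (ChainSum c')),
    (∀ x, U (e x) = {a x}) → (∀ x, U' (e x) = {a' x}) → (∀ x, U (s x) = S x) →
    (∀ x, U' (s x) = S' x) → φ.Sat (ChainSum c) a S → φ.Sat (ChainSum c') a' S' := by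
  induction φ with
  | rel R x =>
    intro c c' τ V k _ U U' h e s a a' S S' ha ha' _ _ hs
    exact h.relMap hL R (fun i => e (x i)) (fun i => ha (x i)) (fun i => ha' (x i)) hs
  | equal x y =>
    intro c c' τ V k _ U U' h e s a a' S S' ha ha' _ _ hs
    exact h.eq_of_eq (ha x) (ha' x) (ha y) (ha' y) hs
  | mem x X =>
    intro c c' τ V k _ U U' h e s a a' S S' ha ha' hS hS' hs
    have := h.mem_of_mem (q := s X) (ha x) (ha' x) (by rw [hS]; exact hs)
    rw [hS'] at this
    exact this
  | not φ ih =>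
    intro c c' τ V k hk U U' h e s a a' S S' ha ha' hS hS' hs hs'
    exact hs (ih c' c τ.symm V k hk U' U h.symm e s a' a S' S ha' ha hS' hS hs')
  | and φ ψ ih1 ih2 =>
    intro c c' τ V k hk U U' h e s a a' S S' ha ha' hS hS' hs
    exact ⟨ih1 c c' τ V k (le_trans (le_max_left _ _) hk) U U' h e s a a' S S' ha ha' hS hS' hs.1,
      ih2 c c' τ V k (le_trans (le_max_right _ _) hk) U U' h e s a a' S S' ha ha' hS hS' hs.2⟩
  | existsElem φ ih =>
    rintro c c' τ V k hk U U' h e s a a' S S' ha ha' hS hS' ⟨b, hb⟩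
    obtain ⟨k, rfl⟩ : ∃ l, k = l + 1 := ⟨k - 1, by simp only [MSO.rank] at hk; omega⟩
    obtain ⟨B', hB'⟩ := h.exists_extendSets {b}
    obtain ⟨b', hb'⟩ := hB'.exists_singleton (p := none) (a := b) rfl
    obtain rfl : B' = {b'} := hb'
    exact ⟨b', ih c c' τ (Option V) k (Nat.le_of_succ_le_succ hk) _ _ hB' _ (fun x => some (s x))
      _ _ S S' (extendSets_snoc (g := fun a => {a}) ha b)
      (extendSets_snoc (g := fun a => {a}) ha' b') hS hS' hb⟩
  | existsSet φ ih =>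
    rintro c c' τ V k hk U U' h e s a a' S S' ha ha' hS hS' ⟨B, hB⟩
    obtain ⟨k, rfl⟩ : ∃ l, k = l + 1 := ⟨k - 1, by simp only [MSO.rank] at hk; omega⟩
    obtain ⟨B', hB'⟩ := h.exists_extendSets B
    exact ⟨B', ih c c' τ (Option V) k (Nat.le_of_succ_le_succ hk) _ _ hB' (fun x => some (e x)) _
      a a' _ _ ha ha' (extendSets_snoc (g := fun B => B) hS B)
      (extendSets_snoc (g := fun B => B) hS' B') hB⟩

end ChainSum

/-! ### Large answers to large sets, and preservation of WMSO+B. -/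

namespace ChainSum

variable {I V : Type} {c c' : Piece I → ℕ} {k : ℕ} {τ : I ≃ I}

/-- All chains of the same role in `c` and `c'` have the same rank `k` type. -/
def Uniform (k : ℕ) (V : Type) (c c' : Piece I → ℕ) : Prop :=
  ∀ r i i', chainType k (fun _ : V => (∅ : Set (Fin (c (some (i, r)))))) =
    chainType k (fun _ : V => (∅ : Set (Fin (c' (some (i', r))))))

theorem Uniform.symm (h : Uniform k V c c') : Uniform k V c' c :=
  fun r i i' => (h r i' i).symm

theorem Uniform.option (h : Uniform (k + 1) V c c') : Uniform k (Option V) c c' :=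
  fun r i i' => chainType_empty_succ (h r i i')

/-- Every length of a chain of some role in `c` occurs for infinitely many chains of this role in
`c'`. -/
def Recurs (c c' : Piece I → ℕ) : Prop :=
  ∀ r i (F : Set I), F.Finite → ∃ i' ∉ F, c' (some (i', r)) = c (some (i, r))

/-- The component `i` contains no element of the sets in the family `U`. -/
def Untouched (U : V → Set (ChainSum c)) (i : I) : Prop :=
  ∀ v r, trace (U v) (some (i, r)) = ∅

theorem Untouched.family_eq {U : V → Set (ChainSum c)} {i : I} (h : Untouched U i) (r : Role) :
    (fun v => trace (U v) (some (i, r))) = fun _ => ∅ :=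
  funext fun v => h v r

theorem finite_touched [Finite V] {U : V → Set (ChainSum c)} (hU : ∀ v, (U v).Finite) :
    {i | ¬ Untouched U i}.Finite := by
  have : {i | ¬ Untouched U i} ⊆
      some ⁻¹' ⋃ v, Option.map Prod.fst '' (piece '' U v) := by
    intro i hi
    simp only [Untouched, Set.mem_ofPred_eq, not_forall, ← ne_eq,
      ← Set.nonempty_iff_ne_empty] at hi
    obtain ⟨v, r, x, hx⟩ := hi
    exact Set.mem_iUnion.2 ⟨v, some (i, r), ⟨_, hx, rfl⟩, rfl⟩
  refine (Set.Finite.preimage (Option.some_injective _).injOn ?_).subset this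
  exact Set.finite_iUnion fun v => ((hU v).image _).image _

variable {U : V → Set (ChainSum c)} {U' : V → Set (ChainSum c')}

theorem Matches.untouched (h : Matches k τ U U') {i : I} (hi : Untouched U i) :
    Untouched U' (τ i) := by
  intro v r
  rw [← Set.not_nonempty_iff_eq_empty]
  intro hne
  have := (trace_nonempty_iff h (some (i, r)) v).2 hne
  rw [hi v r] at this
  exact Set.not_nonempty_empty this

open Classical in
/-- Untouched components can be matched with each other. -/
theorem Matches.rematch (h : Matches k τ U U') (hu : Uniform k V c c') {i i' : I}
    (hi : Untouched U i) (hi' : Untouched U' i') :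
    ∃ τ' : I ≃ I, τ' i = i' ∧ Matches k τ' U U' := by
  have hpre : Untouched U (τ.symm i') := h.symm.untouched hi'
  -- Only `i` and the old partner of `i'` change partners. All four components involved are
  -- untouched, so `Uniform` supplies the new equalities of types.
  refine ⟨(Equiv.swap i (τ.symm i')).trans τ, by simp, ?_⟩
  rintro (_ | ⟨j, r⟩)
  · exact h none
  change _ = chainType k (fun v => trace (U' v)
    (some (τ (Equiv.swap i (τ.symm i') j), r)))
  by_cases h1 : j = i
  · subst h1
    have h2 : τ (Equiv.swap j (τ.symm i') j) = i' := by simp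
    rw [h2, hi.family_eq, hi'.family_eq]
    exact hu r j i'
  by_cases h2 : j = τ.symm i'
  · have h3 : τ (Equiv.swap i (τ.symm i') j) = τ i := by simp [h2]
    rw [h3, (h.untouched hi).family_eq, h2, hpre.family_eq]
    exact hu r _ _
  · rw [Equiv.swap_apply_of_ne_of_ne h1 h2]
    exact h (some (j, r))

theorem chainType_extendSets_cast {n n' : ℕ} (hn : n' = n) (B : Set (Fin n)) :
    ∃ Y : Set (Fin n'), chainType k (extendSets (fun _ : V => (∅ : Set (Fin n))) B) =
      chainType k (extendSets (fun _ : V => (∅ : Set (Fin n'))) Y) ∧ Y.ncard = B.ncard := by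
  subst hn
  exact ⟨B, rfl, rfl⟩

theorem ncard_trace_le {B : Set (ChainSum c)} (hB : B.Finite) (j : Piece I) :
    (trace B j).ncard ≤ B.ncard :=
  Set.ncard_le_ncard_of_injOn (fun x => (⟨j, x⟩ : ChainSum c)) (fun _ hx => hx)
    (fun x _ y _ hxy => by simpa using hxy) hB

/-- A large set in an untouched component has a large response. -/
theorem Matches.exists_large_of_untouched [Finite V] (h : Matches (k + 1) τ U U')
    (hu : Uniform (k + 1) V c c') (hr : Recurs c c') (hU' : ∀ v, (U' v).Finite)
    {B : Set (ChainSum c)} (hB : B.Finite) {i : I} (hi : Untouched U i) (r : Role) :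
    ∃ (τ' : I ≃ I) (B' : Set (ChainSum c')),
      Matches k τ' (extendSets U B) (extendSets U' B') ∧
        (trace B (some (i, r))).ncard ≤ B'.ncard := by
  -- Only finitely many components are touched and the length recurs infinitely often, so an
  -- untouched component with a chain of exactly this length exists.
  obtain ⟨i', hi', hlen⟩ := hr r i _ (finite_touched hU')
  rw [Set.mem_ofPred_eq, not_not] at hi'
  obtain ⟨τ', hτ', h'⟩ := h.rematch hu hi hi'
  obtain ⟨B', hB', hQ⟩ := exists_matches_extendSets (k := k) (τ := τ') (U := U) (U' := U') B
    (fun j Y => j = some (i, r) → Y.ncard = (trace B j).ncard) (by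
      intro j
      by_cases hj : j = some (i, r)
      · subst hj
        have hj' : Piece.perm τ' (some (i, r)) = some (i', r) := by
          rw [← hτ']; rfl
        rw [hj', hi.family_eq, hi'.family_eq]
        obtain ⟨Y, hY, hY'⟩ := chainType_extendSets_cast (k := k) (V := V) hlen
          (trace B (some (i, r)))
        exact ⟨Y, hY, fun _ => hY'⟩
      · obtain ⟨Y, hY⟩ := exists_chainType_extendSets_eq (h' j) (trace B j)
        exact ⟨Y, hY, fun hj' => absurd hj' hj⟩)
  refine ⟨τ', B', hB', ?_⟩
  rw [← hQ _ rfl]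
  exact ncard_trace_le (hB'.finite (p := none) hB) _

/-- Matched sets meet corresponding pieces, and each piece met contributes at least one element. -/
theorem Matches.ncard_image_piece_le (h : Matches k τ U U') {p : V} (hp : (U p).Finite) :
    (piece '' U p).ncard ≤ (U' p).ncard := by
  have hfin := h.finite hp
  refine le_trans (Set.ncard_le_ncard_of_injOn (Piece.perm τ) ?_
    (Piece.perm τ).injective.injOn (hfin.image _)) (Set.ncard_image_le (f := piece) hfin)
  rintro _ ⟨⟨j, x⟩, hx, rfl⟩
  obtain ⟨y, hy⟩ := (trace_nonempty_iff h j p).1 ⟨x, hx⟩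
  exact ⟨_, hy, rfl⟩

/-- If `B` is sufficiently large, then it has a response with at least `N` elements. -/
theorem Matches.exists_large [Finite V] (h : Matches (k + 1) τ U U')
    (hu : Uniform (k + 1) V c c') (hr : Recurs c c') (hU : ∀ v, (U v).Finite) (N : ℕ) :
    ∃ M : ℕ, ∀ B : Set (ChainSum c), B.Finite → M < B.ncard →
      ∃ (τ' : I ≃ I) (B' : Set (ChainSum c')),
        Matches k τ' (extendSets U B) (extendSets U' B') ∧ N ≤ B'.ncard := by
  classical
  have hU' : ∀ v, (U' v).Finite := fun v => h.finite (hU v)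
  have hT : {j : Piece I | ∀ i r, j = some (i, r) → ¬ Untouched U i}.Finite := by
    refine (((finite_touched hU).prod (Set.finite_univ (α := Role))).image some).insert none
      |>.subset ?_
    rintro (_ | ⟨i, r⟩) hj
    · exact Or.inl rfl
    · exact Or.inr ⟨(i, r), ⟨hj i r rfl, trivial⟩, rfl⟩
  obtain ⟨L, hL⟩ := (hT.image c).bddAbove
  -- `L` bounds the sizes of the common point and of all pieces in touched components. If `B` meets
  -- fewer than `N` pieces, some trace has more than `max N L` elements, so its piece must be in an
  -- untouched component.
  refine ⟨N * max N L, fun B hB hM => ?_⟩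
  by_cases hpieces : N ≤ (piece '' B).ncard
  · obtain ⟨B', hB'⟩ := h.exists_extendSets B
    exact ⟨τ, B', hB', hpieces.trans (hB'.ncard_image_piece_le (p := none) hB)⟩
  · obtain ⟨b, rfl⟩ := hB.exists_finset_coe
    rw [Set.ncard_coe_finset] at hM
    rw [← Finset.coe_image, Set.ncard_coe_finset, not_le] at hpieces
    obtain ⟨j, -, hj⟩ := Finset.exists_lt_card_fiber_of_mul_lt_card_of_maps_to
      (s := b) (t := b.image piece) (f := piece) (n := max N L)
      (fun _ ha => Finset.mem_image_of_mem _ ha)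
      (lt_of_le_of_lt (Nat.mul_le_mul_right _ hpieces.le) hM)
    have hfib : (b.filter fun x => x.piece = j).card ≤ (trace (b : Set (ChainSum c)) j).ncard := by
      rw [← Set.ncard_coe_finset]
      refine le_trans (Set.ncard_le_ncard ?_ ((Set.toFinite _).image fun x => ⟨j, x⟩))
        (Set.ncard_image_le (f := fun x => (⟨j, x⟩ : ChainSum c)) (Set.toFinite _))
      rintro ⟨j', x⟩ hx
      simp only [Finset.coe_filter, Set.mem_ofPred_eq] at hx
      obtain ⟨hx, rfl⟩ := hx
      exact ⟨x, hx, rfl⟩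
    have hle : (trace (b : Set (ChainSum c)) j).ncard ≤ c j := by
      simpa using Set.ncard_le_card (trace (b : Set (ChainSum c)) j)
    have hj' : j ∉ {j : Piece I | ∀ i r, j = some (i, r) → ¬ Untouched U i} := by
      intro hmem
      have := hL (Set.mem_image_of_mem c hmem)
      have := le_max_right N L
      omega
    simp only [Set.mem_ofPred_eq, not_forall, not_not] at hj'
    obtain ⟨i, r, rfl, hi⟩ := hj'
    obtain ⟨τ', B', h1, h2⟩ := h.exists_large_of_untouched hu hr hU' hB hi r
    have := le_max_left N L
    exact ⟨τ', B', h1, by omega⟩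

/-- As for MSO, except that parameters stay finite and the permutation may change in the case of
`bound`. `Recurs` is needed in both directions because negation exchanges the structures. -/
theorem wmsob_sat {L : FirstOrder.Language.{0, 0}} {I : Type}
    [∀ c : Piece I → ℕ, L.Structure (ChainSum c)] (hL : Determined L I) {n m : ℕ}
    (φ : WMSOB L n m) : ∀ (c c' : Piece I → ℕ), Recurs c c' → Recurs c' c →
    ∀ (τ : I ≃ I) (V : Type) (_ : Finite V) (k : ℕ), Uniform k V c c' → φ.rank ≤ k →
    ∀ (U : V → Set (ChainSum c)) (U' : V → Set (ChainSum c')), Matches k τ U U' →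
    (∀ v, (U v).Finite) →
    ∀ (e : Fin n → V) (s : Fin m → V) (a : Fin n → ChainSum c) (a' : Fin n → ChainSum c')
      (S : Fin m → Finset (ChainSum c)) (S' : Fin m → Finset (ChainSum c')),
    (∀ x, U (e x) = {a x}) → (∀ x, U' (e x) = {a' x}) → (∀ x, U (s x) = S x) →
    (∀ x, U' (s x) = S' x) → φ.Sat (ChainSum c) a S → φ.Sat (ChainSum c') a' S' := by
  have hext : ∀ {c : Piece I → ℕ} {V : Type} {U : V → Set (ChainSum c)} {B : Set (ChainSum c)},
      (∀ v, (U v).Finite) → B.Finite → ∀ v, (extendSets U B v).Finite := by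
    intro c V U B hU hB v
    cases v
    exacts [hB, hU _]
  induction φ with
  | rel R x =>
    intro c c' _ _ τ V _ k _ _ U U' h _ e s a a' S S' ha ha' _ _ hs
    exact h.relMap hL R (fun i => e (x i)) (fun i => ha (x i)) (fun i => ha' (x i)) hs
  | equal x y =>
    intro c c' _ _ τ V _ k _ _ U U' h _ e s a a' S S' ha ha' _ _ hs
    exact h.eq_of_eq (ha x) (ha' x) (ha y) (ha' y) hs
  | mem x X =>
    intro c c' _ _ τ V _ k _ _ U U' h _ e s a a' S S' ha ha' hS hS' hs
    have := h.mem_of_mem (q := s X) (ha x) (ha' x) (by rw [hS]; exact hs)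
    rw [hS'] at this
    exact this
  | not φ ih =>
    intro c c' hr hr' τ V _ k hu hk U U' h hU e s a a' S S' ha ha' hS hS' hs hs'
    exact hs (ih c' c hr' hr τ.symm V ‹_› k hu.symm hk U' U h.symm (fun v => h.finite (hU v))
      e s a' a S' S ha' ha hS' hS hs')
  | and φ ψ ih1 ih2 =>
    intro c c' hr hr' τ V _ k hu hk U U' h hU e s a a' S S' ha ha' hS hS' hs
    exact ⟨ih1 c c' hr hr' τ V ‹_› k hu (le_trans (le_max_left _ _) hk) U U' h hU e s a a' S S'
        ha ha' hS hS' hs.1,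
      ih2 c c' hr hr' τ V ‹_› k hu (le_trans (le_max_right _ _) hk) U U' h hU e s a a' S S'
        ha ha' hS hS' hs.2⟩
  | existsElem φ ih =>
    rintro c c' hr hr' τ V _ k hu hk U U' h hU e s a a' S S' ha ha' hS hS' ⟨b, hb⟩
    obtain ⟨k, rfl⟩ : ∃ l, k = l + 1 := ⟨k - 1, by simp only [WMSOB.rank] at hk; omega⟩
    obtain ⟨B', hB'⟩ := h.exists_extendSets {b}
    obtain ⟨b', hb'⟩ := hB'.exists_singleton (p := none) (a := b) rfl
    obtain rfl : B' = {b'} := hb'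
    exact ⟨b', ih c c' hr hr' τ (Option V) inferInstance k hu.option (Nat.le_of_succ_le_succ hk)
      _ _ hB' (hext hU (Set.finite_singleton b)) _ (fun x => some (s x))
      _ _ S S' (extendSets_snoc (g := fun a => {a}) ha b)
      (extendSets_snoc (g := fun a => {a}) ha' b') hS hS' hb⟩
  | existsSet φ ih =>
    rintro c c' hr hr' τ V _ k hu hk U U' h hU e s a a' S S' ha ha' hS hS' ⟨B, hB⟩
    obtain ⟨k, rfl⟩ : ∃ l, k = l + 1 := ⟨k - 1, by simp only [WMSOB.rank] at hk; omega⟩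
    obtain ⟨B', hB'⟩ := h.exists_extendSets (B : Set (ChainSum c))
    obtain ⟨b', rfl⟩ := (hB'.finite (p := none) B.finite_toSet).exists_finset_coe
    exact ⟨b', ih c c' hr hr' τ (Option V) inferInstance k hu.option (Nat.le_of_succ_le_succ hk)
      _ _ hB' (hext hU B.finite_toSet) (fun x => some (e x))
      (Fin.snoc (α := fun _ => Option V) (fun x => some (s x)) none)
      a a' _ _ ha ha' (extendSets_snoc (g := fun B : Finset (ChainSum c) => (B : Set (ChainSum c))) hS B)
      (extendSets_snoc (g := fun B : Finset (ChainSum c') => (B : Set (ChainSum c'))) hS' b') hB⟩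
  | bound φ ih =>
    rintro c c' hr hr' τ V _ k hu hk U U' h hU e s a a' S S' ha ha' hS hS' ⟨N, hN⟩
    obtain ⟨k, rfl⟩ : ∃ l, k = l + 1 := ⟨k - 1, by simp only [WMSOB.rank] at hk; omega⟩
    have hU' : ∀ v, (U' v).Finite := fun v => h.finite (hU v)
    -- A set with more than `M` elements on the second side would be answered by one with more than
    -- `N` on the first, contradicting the bound there.
    obtain ⟨M, hM⟩ := h.symm.exists_large hu.symm hr' hU' (N + 1)
    refine ⟨M, fun B' hB' => ?_⟩
    by_contra hlt
    obtain ⟨τ', B, hB, hcard⟩ := hM B' B'.finite_toSet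
      (by rw [Set.ncard_coe_finset]; omega)
    obtain ⟨b, rfl⟩ := (hB.finite (p := none) B'.finite_toSet).exists_finset_coe
    have := hN b (ih c' c hr' hr τ' (Option V) inferInstance k hu.symm.option
      (Nat.le_of_succ_le_succ hk) _ _ hB (hext hU' B'.finite_toSet) (fun x => some (e x))
      (Fin.snoc (α := fun _ => Option V) (fun x => some (s x)) none)
      a' a _ _ ha' ha (extendSets_snoc (g := fun B : Finset (ChainSum c') => (B : Set (ChainSum c'))) hS' B')
      (extendSets_snoc (g := fun B : Finset (ChainSum c) => (B : Set (ChainSum c))) hS b) hB')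
    rw [Set.ncard_coe_finset] at hcard
    omega

end ChainSum

/-! ### Boolean combinations. -/

/-- The quantifier rank. -/
def BoolSentence.rank {L : FirstOrder.Language.{0, 0}} : BoolSentence L → ℕ
  | .mso φ => φ.rank
  | .wmsob φ => φ.rank
  | .not ψ => ψ.rank
  | .and ψ χ => max ψ.rank χ.rank

namespace ChainSum

theorem matches_empty {I : Type} {k : ℕ} {c c' : Piece I → ℕ} (hu : Uniform k Empty c c')
    (hc : c none = c' none) (U : Empty → Set (ChainSum c)) (U' : Empty → Set (ChainSum c')) :
    Matches k (Equiv.refl I) U U' := by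
  have cast : ∀ n n', n = n' → ∀ (X : Empty → Set (Fin n)) (X' : Empty → Set (Fin n')),
      chainType k X = chainType k X' := by
    rintro n _ rfl X X'
    rw [Subsingleton.elim X X']
  rintro (_ | ⟨i, r⟩)
  · exact cast _ _ hc _ _
  · exact (cast _ _ rfl _ _).trans ((hu r i i).trans (cast _ _ rfl _ _))

theorem boolSentence_holds_iff {L : FirstOrder.Language.{0, 0}} {I : Type}
    [∀ c : Piece I → ℕ, L.Structure (ChainSum c)] (hL : Determined L I) {k : ℕ}
    {c c' : Piece I → ℕ} (hr : Recurs c c') (hr' : Recurs c' c) (hu : Uniform k Empty c c')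
    (hc : c none = c' none) (ψ : BoolSentence L) (hk : ψ.rank ≤ k) :
    ψ.Holds (ChainSum c) ↔ ψ.Holds (ChainSum c') := by
  induction ψ with
  | mso φ =>
    exact ⟨mso_sat hL φ c c' _ Empty k hk _ _ (matches_empty hu hc Empty.elim Empty.elim)
        Fin.elim0 Fin.elim0 _ _ _ _ nofun nofun nofun nofun,
      mso_sat hL φ c' c _ Empty k hk _ _ (matches_empty hu.symm hc.symm Empty.elim Empty.elim)
        Fin.elim0 Fin.elim0 _ _ _ _ nofun nofun nofun nofun⟩
  | wmsob φ =>
    exact ⟨wmsob_sat hL φ c c' hr hr' _ Empty inferInstance k hu hk _ _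
        (matches_empty hu hc Empty.elim Empty.elim) nofun
        Fin.elim0 Fin.elim0 _ _ _ _ nofun nofun nofun nofun,
      wmsob_sat hL φ c' c hr' hr _ Empty inferInstance k hu.symm hk _ _
        (matches_empty hu.symm hc.symm Empty.elim Empty.elim) nofun
        Fin.elim0 Fin.elim0 _ _ _ _ nofun nofun nofun nofun⟩
  | not ψ ih => exact not_congr (ih hk)
  | and ψ χ ih1 ih2 =>
    exact and_congr (ih1 (le_trans (le_max_left _ _) hk)) (ih2 (le_trans (le_max_right _ _) hk))

end ChainSum

/-! ### Both signatures on sums of chains, and the obstruction to mapping into the tree. -/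

namespace ChainSum

variable {I : Type} {c : Piece I → ℕ}

instance [Countable I] : Countable (ChainSum c) :=
  Function.Injective.countable (f := fun a => (⟨a.piece, a.pos⟩ : Σ j, Fin (c j)))
    fun ⟨_, _⟩ ⟨_, _⟩ h => by simpa using h

instance instOrder (c : Piece I → ℕ) : orderSig.Structure (ChainSum c) where
  funMap := fun f _ => nomatch f
  RelMap := fun R v =>
    match R, v with
    | OrderRel.lt, v => Lt (v 0) (v 1)
    | OrderRel.bot, v => Bot (v 0) (v 1)

instance instOrderEq (c : Piece I → ℕ) : orderEqSig.Structure (ChainSum c) where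
  funMap := fun f _ => nomatch f
  RelMap := fun R v =>
    match R, v with
    | OrderEqRel.lt, v => Lt (v 0) (v 1)
    | OrderEqRel.bot, v => Bot (v 0) (v 1)
    | OrderEqRel.eq, v => v 0 = v 1

theorem determined_orderSig : Determined orderSig I := by
  rintro c c' _ (_ | _) a a' hlt hbot heq h
  · exact (hlt 0 1).1 h
  · exact (hbot 0 1).1 h

theorem determined_orderEqSig : Determined orderEqSig I := by
  rintro c c' _ (_ | _ | _) a a' hlt hbot heq h
  · exact (hlt 0 1).1 h
  · exact (hbot 0 1).1 h
  · exact (heq 0 1).1 h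

theorem interpretsEq : InterpretsEq (ChainSum c) := fun _ _ => Iff.rfl

/-- A map to the tree that preserves order and incomparability. -/
def IsTreeMap (g : ChainSum c → TInf) : Prop :=
  (∀ a b, a.Lt b → TInf.lt (g a) (g b)) ∧ ∀ a b, a.Bot b → TInf.bot (g a) (g b)

theorem nonempty_orderSig_hom_iff :
    Nonempty (ChainSum c →[orderSig] TInf) ↔ ∃ g : ChainSum c → TInf, IsTreeMap g := by
  constructor
  · rintro ⟨h⟩
    exact ⟨h, fun a b hab => h.map_rel (OrderRel.lt : orderSig.Relations 2) ![a, b] hab,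
      fun a b hab => h.map_rel (OrderRel.bot : orderSig.Relations 2) ![a, b] hab⟩
  · rintro ⟨g, hlt, hbot⟩
    refine ⟨⟨g, fun {_} f => (nomatch f), fun {_} => ?_⟩⟩
    rintro (_ | _) v h
    · exact hlt _ _ h
    · exact hbot _ _ h

theorem nonempty_orderEqSig_hom_iff :
    Nonempty (ChainSum c →[orderEqSig] TInf) ↔ ∃ g : ChainSum c → TInf, IsTreeMap g := by
  constructor
  · rintro ⟨h⟩
    exact ⟨h, fun a b hab => h.map_rel (OrderEqRel.lt : orderEqSig.Relations 2) ![a, b] hab,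
      fun a b hab => h.map_rel (OrderEqRel.bot : orderEqSig.Relations 2) ![a, b] hab⟩
  · rintro ⟨g, hlt, hbot⟩
    refine ⟨⟨g, fun {_} f => (nomatch f), fun {_} => ?_⟩⟩
    rintro (_ | _ | _) v h
    · exact hlt _ _ h
    · exact hbot _ _ h
    · exact congrArg g h

/-- The lengths of the pieces, if the chains of the component `i` have lengths `n i` and `m i`. -/
def sizes (n m : I → ℕ) : Piece I → ℕ
  | some (i, .left) => n i
  | some (i, .right) => m i
  | _ => 1

theorem le_length_of_chain {g : ChainSum c → TInf} (hg : IsTreeMap g) (j : Piece I) :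
    ∀ (p : ℕ) (hp : p < c j), p ≤ List.length (g ⟨j, ⟨p, hp⟩⟩)
  | 0, _ => Nat.zero_le _
  | p + 1, hp => by
    have ih := le_length_of_chain hg j p (Nat.lt_of_succ_lt hp)
    obtain ⟨h1, h2⟩ := hg.1 ⟨j, ⟨p, Nat.lt_of_succ_lt hp⟩⟩ ⟨j, ⟨p + 1, hp⟩⟩
      (Or.inl ⟨rfl, Nat.lt_succ_self p⟩)
    have := h1.length_le
    rcases this.lt_or_eq with h | h
    · omega
    · exact absurd (h1.eq_of_length h) h2

/-- If the components have arbitrarily long pairs of chains, then there is no map to the tree. -/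
theorem not_exists_isTreeMap {n m : I → ℕ} (h : ∀ d, ∃ i, d < n i ∧ d < m i) :
    ¬ ∃ g : ChainSum (sizes n m) → TInf, IsTreeMap g := by
  rintro ⟨g, hg⟩
  set u : ChainSum (sizes n m) := ⟨none, (0 : Fin 1)⟩ with hu
  -- The elements at position `List.length (g u)` of both chains have images at least as long as
  -- that of `u`. So wherever such an image and `g u` are prefixes of one word, `g u` is the shorter
  -- prefix.
  obtain ⟨i, hn, hm⟩ := h (List.length (g u))
  set x : ChainSum (sizes n m) := ⟨some (i, .left), ⟨_, hn⟩⟩ with hx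
  set y : ChainSum (sizes n m) := ⟨some (i, .right), ⟨_, hm⟩⟩ with hy
  set b : ChainSum (sizes n m) := ⟨some (i, .leftEnd), (0 : Fin 1)⟩ with hb
  set b' : ChainSum (sizes n m) := ⟨some (i, .rightEnd), (0 : Fin 1)⟩ with hb'
  set q : ChainSum (sizes n m) := ⟨some (i, .join), (0 : Fin 1)⟩ with hq
  have hlx : List.length (g u) ≤ List.length (g x) :=
    le_length_of_chain hg (some (i, .left)) _ hn
  have hly : List.length (g u) ≤ List.length (g y) :=
    le_length_of_chain hg (some (i, .right)) _ hm
  have hxb := (hg.1 x b (Or.inr ⟨rfl, trivial⟩)).1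
  have hxq := (hg.1 x q (Or.inr ⟨rfl, trivial⟩)).1
  have hyb' := (hg.1 y b' (Or.inr ⟨rfl, trivial⟩)).1
  have hyq := (hg.1 y q (Or.inr ⟨rfl, trivial⟩)).1
  have hub := (hg.1 u b (Or.inr rfl)).1
  have hub' := (hg.2 u b' rfl).1
  rcases List.prefix_or_prefix_of_prefix hxq hyq with hxy | hyx
  · exact hub' (((List.prefix_of_prefix_length_le hub hxb hlx).trans hxy).trans hyb')
  · exact hub' ((List.prefix_of_prefix_length_le hub (hyx.trans hxb) hly).trans hyb')

end ChainSum

/-! ### Explicit maps into the tree. -/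

namespace TInf

/-- The word `0ᵃ1ᵈ`. -/
def word (a d : ℕ) : TInf := (List.replicate a 0 ++ List.replicate d 1 : List ℕ)

theorem lt_word_of_lt_left {a a' d' : ℕ} (h : a < a') : lt (word a 0) (word a' d') := by
  obtain ⟨e, rfl⟩ := Nat.exists_eq_add_of_lt h
  constructor
  · refine ⟨List.replicate (e + 1) 0 ++ List.replicate d' 1, ?_⟩
    change List.replicate a 0 ++ List.replicate 0 1 ++ _ = (_ : List ℕ)
    simp only [word, Nat.add_assoc, List.replicate_add a, List.replicate_zero,
      List.append_nil, List.append_assoc]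
  · intro he
    have := congrArg List.length he
    simp [word] at this
    omega

theorem lt_word_of_lt_right {a d d' : ℕ} (h : d < d') : lt (word a d) (word a d') := by
  obtain ⟨e, rfl⟩ := Nat.exists_eq_add_of_lt h
  constructor
  · refine ⟨List.replicate (e + 1) 1, ?_⟩
    simp only [word, Nat.add_assoc, List.replicate_add d]
    simp
  · intro he
    have := congrArg List.length he
    simp [word] at this
    omega

theorem bot_word (a d : ℕ) : bot (word (a + 1) 0) (word a (d + 1)) := by
  constructor
  all_goals
    intro h
    -- The two words differ at position `a`: one has the letter 0, the other 1.
    have := List.IsPrefix.getElem (i := a) h (by simp [word])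
    simp [word] at this

end TInf

namespace ChainSum

variable {I : Type}

/-- The image of an element of a component whose left chain has length at most `K`. -/
def wordLeft (K m : ℕ) : Role → ℕ → TInf
  | .left, p => TInf.word p 0
  | .right, p => TInf.word K (p + 1)
  | .join, _ => TInf.word K (m + 1)
  | .leftEnd, _ => TInf.word (K + 2) 0
  | .rightEnd, _ => TInf.word K (m + 1)

/-- The image of an element of a component whose right chain has length at most `K`. -/
def wordRight (K n : ℕ) : Role → ℕ → TInf
  | .left, p => TInf.word (K + 2 + p) 0
  | .right, p => TInf.word p 0
  | .join, _ => TInf.word (K + 2 + n) 0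
  | .leftEnd, _ => TInf.word (K + 2 + n) 0
  | .rightEnd, _ => TInf.word K 1

/-- If every component has a chain of length at most `K`, then there is a map to the tree. -/
theorem exists_isTreeMap {n m : I → ℕ} (K : ℕ) (h : ∀ i, n i ≤ K ∨ m i ≤ K) :
    ∃ g : ChainSum (sizes n m) → TInf, IsTreeMap g := by
  have key : ∀ i, ∃ w : Role → ℕ → TInf,
      (∀ r p p', p < p' → p' < sizes n m (some (i, r)) → TInf.lt (w r p) (w r p')) ∧
      (∀ r r' p p', r.Lt r' → p < sizes n m (some (i, r)) → p' < sizes n m (some (i, r')) →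
        TInf.lt (w r p) (w r' p')) ∧
      (∀ p, TInf.lt (TInf.word (K + 1) 0) (w .leftEnd p)) ∧
      ∀ p, TInf.bot (TInf.word (K + 1) 0) (w .rightEnd p) := by
    intro i
    rcases h i with hi | hi
    -- The common point goes to `0^(K+1)`. A short left chain fits below `0^K`, so the right chain
    -- can leave the path to the common point there and take the join with it.
    · refine ⟨wordLeft K (m i), ?_, ?_, fun p => TInf.lt_word_of_lt_left (by omega),
        fun p => TInf.bot_word _ _⟩
      · rintro (_ | _) p p' hp hp' <;> simp only [sizes] at hp' <;> try omega
        · exact TInf.lt_word_of_lt_left hp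
        · exact TInf.lt_word_of_lt_right (by omega)
      · rintro (_ | _) (_ | _) p p' hr hp hp' <;> simp only [Role.Lt] at hr <;>
          simp only [sizes] at hp hp'
        · exact TInf.lt_word_of_lt_left (by omega)
        · exact TInf.lt_word_of_lt_left (by omega)
        · exact TInf.lt_word_of_lt_right (by omega)
        · exact TInf.lt_word_of_lt_right (by omega)
    -- A short right chain stays strictly below `0^K`, so its end can branch off at `0^K 1`, while
    -- the left chain and the join lie above the common point.
    · refine ⟨wordRight K (n i), ?_, ?_, fun p => TInf.lt_word_of_lt_left (by omega),
        fun p => TInf.bot_word _ _⟩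
      · rintro (_ | _) p p' hp hp' <;> simp only [sizes] at hp' <;> try omega
        · exact TInf.lt_word_of_lt_left (by omega)
        · exact TInf.lt_word_of_lt_left hp
      · rintro (_ | _) (_ | _) p p' hr hp hp' <;> simp only [Role.Lt] at hr <;>
          simp only [sizes] at hp hp'
        all_goals exact TInf.lt_word_of_lt_left (by omega)
  choose w h1 h2 h3 h4 using key
  refine ⟨fun a => match a with
    | ⟨none, _⟩ => TInf.word (K + 1) 0
    | ⟨some (i, r), p⟩ => w i r p, ?_, ?_⟩
  · rintro ⟨_ | ⟨i, r⟩, p⟩ ⟨_ | ⟨i', r'⟩, p'⟩ (⟨hj, hp⟩ | hlt)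
    · have := p'.2
      simp only [sizes] at this hp
      omega
    · exact hlt.elim
    · cases hj
    · obtain rfl : r' = .leftEnd := hlt
      exact h3 _ _
    · cases hj
    · exact hlt.elim
    · cases hj
      exact h1 i r p p' hp p'.2
    · obtain ⟨rfl, hr⟩ := hlt
      exact h2 i r r' p p' hr p.2 p'.2
  · rintro ⟨_ | ⟨i, r⟩, p⟩ ⟨_ | ⟨i', r'⟩, p'⟩ hbot
    · exact hbot.elim
    · obtain rfl : r' = .rightEnd := hbot
      exact h4 _ _
    · exact hbot.elim
    · exact hbot.elim

/-! ### The two indistinguishable structures and the conclusion. -/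

theorem exists_notMem_of_injective {φ : ℕ → I} (hφ : φ.Injective) {F : Set I} (hF : F.Finite) :
    ∃ r, φ r ∉ F :=
  (hF.preimage hφ.injOn).exists_notMem

/-- For every rank there are two sums of chains that cannot be distinguished by formulas of this
rank, and only the first one has a map to the tree. -/
theorem exists_indistinguishable (k : ℕ) : ∃ c c' : Piece (Bool × ℕ × ℕ) → ℕ,
    Recurs c c' ∧ Recurs c' c ∧ Uniform k Empty c c' ∧ c none = 1 ∧ c' none = 1 ∧
      (∃ g : ChainSum c → TInf, IsTreeMap g) ∧ ¬ ∃ g : ChainSum c' → TInf, IsTreeMap g := by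
  obtain ⟨f, hf, htype⟩ := exists_strictMono_chainType_eq k
  -- In the first structure the Boolean selects the side with the shortest length `f 0`, and the
  -- last coordinate only creates infinitely many copies. In the second, the two numbers give the
  -- two lengths independently.
  refine ⟨sizes (fun i => if i.1 then f 0 else f i.2.1) (fun i => if i.1 then f i.2.1 else f 0),
    sizes (fun i => f i.2.1) (fun i => f i.2.2), ?_, ?_, ?_, rfl, rfl,
    exists_isTreeMap (f 0) ?_, not_exists_isTreeMap ?_⟩
  · have hfst : ∀ s : ℕ, Function.Injective fun r : ℕ => (true, s, r) := fun (s : ℕ) r r' h => by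
      simpa using h
    have hsnd : ∀ s : ℕ, Function.Injective fun r : ℕ => (true, r, s) := fun (s : ℕ) r r' h => by
      simpa using h
    rintro (_ | _ | _ | _ | _) ⟨β, t, r⟩ F hF
    · obtain ⟨r', hr'⟩ := exists_notMem_of_injective (hfst (if β then 0 else t)) hF
      exact ⟨_, hr', by cases β <;> simp [sizes]⟩
    · obtain ⟨r', hr'⟩ := exists_notMem_of_injective (hsnd (if β then t else 0)) hF
      exact ⟨_, hr', by cases β <;> simp [sizes]⟩
    all_goals
      obtain ⟨r', hr'⟩ := exists_notMem_of_injective (hfst 0) hF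
      exact ⟨_, hr', rfl⟩
  · have hinj : ∀ (β : Bool) (s : ℕ), Function.Injective fun r : ℕ => (β, s, r) :=
      fun β s r r' h => by simpa using h
    rintro (_ | _ | _ | _ | _) ⟨β, t, r⟩ F hF
    · obtain ⟨r', hr'⟩ := exists_notMem_of_injective (hinj false t) hF
      exact ⟨_, hr', by simp [sizes]⟩
    · obtain ⟨r', hr'⟩ := exists_notMem_of_injective (hinj true r) hF
      exact ⟨_, hr', by simp [sizes]⟩
    all_goals
      obtain ⟨r', hr'⟩ := exists_notMem_of_injective (hinj true 0) hF
      exact ⟨_, hr', rfl⟩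
  · rintro (_ | _ | _ | _ | _) ⟨_ | _, t, r⟩ ⟨β', t', r'⟩
    all_goals first | rfl | exact htype _ _
  · rintro ⟨_ | _, t, r⟩
    · exact Or.inr le_rfl
    · exact Or.inl le_rfl
  · intro d
    -- A strictly increasing `f` satisfies `d + 1 ≤ f (d + 1)`.
    have : d < f (d + 1) := hf.le_apply
    exact ⟨(true, d + 1, d + 1), this, this⟩

theorem nonempty_of_none_eq {c : Piece I → ℕ} (h : c none = 1) : Nonempty (ChainSum c) :=
  ⟨⟨none, ⟨0, by omega⟩⟩⟩

end ChainSum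

theorem theorem1 :
    (¬ ∃ ψ : BoolSentence orderEqSig,
      ∀ (A : Type) [Nonempty A] [Countable A] [orderEqSig.Structure A], InterpretsEq A →
        (ψ.Holds A ↔ Nonempty (A →[orderEqSig] TInf))) ∧
    ¬ HasEHD {⟨TInf, TInf.instOrder⟩} := by
  constructor
  · rintro ⟨ψ, hψ⟩
    obtain ⟨c, c', hr, hr', hu, hc, hc', htree, hno⟩ := ChainSum.exists_indistinguishable ψ.rank
    have := ChainSum.nonempty_of_none_eq hc
    have := ChainSum.nonempty_of_none_eq hc'
    have h1 := (hψ _ ChainSum.interpretsEq).2 (ChainSum.nonempty_orderEqSig_hom_iff.2 htree)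
    have h2 := (ChainSum.boolSentence_holds_iff ChainSum.determined_orderEqSig hr hr' hu
      (hc.trans hc'.symm) ψ le_rfl).1 h1
    exact hno (ChainSum.nonempty_orderEqSig_hom_iff.1 ((hψ _ ChainSum.interpretsEq).1 h2))
  · rintro ⟨ψ, hψ⟩
    obtain ⟨c, c', hr, hr', hu, hc, hc', htree, hno⟩ := ChainSum.exists_indistinguishable ψ.rank
    have := ChainSum.nonempty_of_none_eq hc
    have := ChainSum.nonempty_of_none_eq hc'
    have h1 := (hψ (ChainSum c)).1 ⟨_, rfl, ChainSum.nonempty_orderSig_hom_iff.2 htree⟩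
    have h2 := (ChainSum.boolSentence_holds_iff ChainSum.determined_orderSig hr hr' hu
      (hc.trans hc'.symm) ψ le_rfl).1 h1
    obtain ⟨_, rfl, hhom⟩ := (hψ (ChainSum c')).2 h2
    exact hno (ChainSum.nonempty_orderSig_hom_iff.1 hhom)
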